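/- Consider unlabeled rooted plane trees; the size of such a tree is its number of vertices. The rank of a vertex is the number of steps of a shortest downward path (a path that moves from parent to child in every step) from that vertex to a leaf. Let $k \ge 0$ be a fixed integer, and let $N_k(n)$ be the number of vertices of rank exactly $k$, summed over all unlabeled rooted plane trees of size $n$. Then, as $n \to \infty$, $$N_k(n) \sim \frac{9\binom{2n-2}{n-1}}{10+4^{1-k}+4^{1+k}},$$ that is, the quotient of the two sides tends to $1$. -/

import Mathlib

open Filter Asymptotics

/-- Unlabeled rooted plane trees: a root together with the (possibly empty) left-to-right ordered
list of the subtrees of its children. -/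
inductive PlaneTree : Type where
  | node (children : List PlaneTree) : PlaneTree

namespace PlaneTree

/-- The ordered list of the subtrees rooted at the children of the root. -/
def children : PlaneTree → List PlaneTree
  | node l => l

mutual
/-- The size of a tree: its number of vertices. -/
def size : PlaneTree → ℕ
  | node l => 1 + sizeForest l
/-- The total number of vertices of an ordered list of trees. -/
def sizeForest : List PlaneTree → ℕ
  | [] => 0
  | t :: l => size t + sizeForest l
end

/-- A vertex is addressed by the list of (zero-based) child indices leading to it from the root.
`t.subtreeAt v` is the subtree of `t` that consists of the vertex `v` and its descendants, and it
is `none` if `t` has no vertex with this address. -/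
def subtreeAt : PlaneTree → List ℕ → Option PlaneTree
  | t, [] => some t
  | t, i :: v => t.children[i]?.bind fun s => subtreeAt s v

/-- `v` is (the address of) a vertex of `t`. -/
def IsVertex (t : PlaneTree) (v : List ℕ) : Prop :=
  ∃ s, t.subtreeAt v = some s

/-- `v` is a leaf of `t`: a vertex without children. -/
def IsLeaf (t : PlaneTree) (v : List ℕ) : Prop :=
  t.subtreeAt v = some (node [])

/-- The vertex `v` of `t` has rank `k`: the shortest downward path from `v` to a leaf has `k`
steps. A downward path of `d` steps from `v` ends at an address `v ++ p` with `p` of length `d`. -/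
def HasRank (t : PlaneTree) (v : List ℕ) (k : ℕ) : Prop :=
  IsLeast {d : ℕ | ∃ p : List ℕ, p.length = d ∧ t.IsLeaf (v ++ p)} k

/-- The number of vertices of rank `k` in all trees of size `n` together, that is, the number of
pairs of a tree of size `n` and a vertex of rank `k` of that tree. -/
noncomputable def rankCount (k n : ℕ) : ℕ :=
  Set.ncard {x : PlaneTree × List ℕ | x.1.size = n ∧ x.1.IsVertex x.2 ∧ x.1.HasRank x.2 k}

end PlaneTree

-- The first-child next-sibling correspondence turns trees with n + 1 vertices into binary trees
-- with n nodes, counted by the Catalan series c. Let P be the series of the trees whose root has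
-- rank k. Marking such a vertex anywhere multiplies P by 1/(2 - c) = (1 + B)/2, where B is the
-- central binomial series (`two_mul_genFun_add`). The coefficients of P lie between 0 and the
-- Catalan numbers, so P converges at 1/4; as consecutive coefficients of B have ratio tending to 4,
-- the coefficients of P(1 + B)/2, divided by those of B, tend to P(1/4)/2
-- (`tendsto_coeff_div_centralBinom`).
--
-- A root has rank at least k + 1 iff it has children and all of them have rank at least k. Hence
-- the values r_k at 1/4 of the corresponding series satisfy r_0 = 2 and r_{k+1} = 1/(1 - r_k/4) -
-- 1, solved by r_k = 6/(2 + 4^k) (`hasSumAtQuarter_minLeafDepthGE`), and P(1/4) = r_k - r_{k+1}.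

open scoped PowerSeries in
/-- The generating function, by number of nodes, of the values of a function on binary trees. -/
noncomputable def BinaryTree.genFun (f : BinaryTree Unit → ℝ) : ℝ⟦X⟧ :=
  PowerSeries.mk fun n => ∑ b ∈ BinaryTree.treesOfNumNodesEq n, f b

-- Generating functions over binary trees; Catalan identities.

namespace BinaryTree

open PowerSeries

theorem coeff_genFun (f : BinaryTree Unit → ℝ) (n : ℕ) :
    coeff n (genFun f) = ∑ b ∈ treesOfNumNodesEq n, f b := by
  simp [genFun]

theorem genFun_add (f g : BinaryTree Unit → ℝ) :
    genFun (fun b => f b + g b) = genFun f + genFun g := by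
  ext n; simp [coeff_genFun, Finset.sum_add_distrib]

theorem genFun_sub (f g : BinaryTree Unit → ℝ) :
    genFun (fun b => f b - g b) = genFun f - genFun g := by
  ext n; simp [coeff_genFun]

theorem sum_treesOfNumNodesEq_succ (f : BinaryTree Unit → ℝ) (n : ℕ) :
    ∑ b ∈ treesOfNumNodesEq (n + 1), f b = ∑ ij ∈ Finset.HasAntidiagonal.antidiagonal n,
      ∑ l ∈ treesOfNumNodesEq ij.1, ∑ r ∈ treesOfNumNodesEq ij.2, f (node () l r) := by
  rw [treesOfNumNodesEq_succ, Finset.sum_biUnion]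
  · refine Finset.sum_congr rfl fun ij _ => ?_
    rw [pairwiseNode, Finset.sum_map, Finset.sum_product]
    rfl
  · rintro ⟨i, j⟩ _ ⟨i', j'⟩ _ h
    simp only [Function.onFun]
    rw [Finset.disjoint_left]
    intro a ha hb
    simp only [pairwiseNode, Finset.mem_map, Finset.mem_product, mem_treesOfNumNodesEq] at ha hb
    obtain ⟨⟨l, r⟩, ⟨h1, h2⟩, rfl⟩ := ha
    obtain ⟨⟨l', r'⟩, ⟨h3, h4⟩, h5⟩ := hb
    simp at h5
    obtain ⟨rfl, rfl⟩ := h5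
    simp_all

theorem genFun_eq_of_node {f g h : BinaryTree Unit → ℝ}
    (hf : ∀ l r, f (node () l r) = g l * h r) :
    genFun f = C (f nil) + X * (genFun g * genFun h) := by
  ext n
  cases n with
  | zero => simp [coeff_genFun, treesOfNumNodesEq_zero, -coeff_zero_eq_constantCoeff, coeff_zero_X_mul]
  | succ n =>
    rw [coeff_genFun, sum_treesOfNumNodesEq_succ, map_add, coeff_succ_X_mul, coeff_mul, coeff_C]
    simp [hf, coeff_genFun, Finset.sum_mul_sum]

/-- The generating function of the Catalan numbers. -/
theorem genFun_one : genFun (fun _ => 1) = 1 + X * (genFun (fun _ => 1) * genFun (fun _ => 1)) := by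
  simpa using genFun_eq_of_node (f := fun _ => 1) (g := fun _ => 1) (h := fun _ => 1) (by simp)

theorem coeff_genFun_one (n : ℕ) : coeff n (genFun fun _ => 1) = (catalan n : ℝ) := by
  simp [coeff_genFun, treesOfNumNodesEq_card_eq_catalan]

open scoped PowerSeries in
/-- The generating function of the central binomial coefficients. -/
noncomputable def centralBinomSeries : ℝ⟦X⟧ := PowerSeries.mk fun n => (n.centralBinom : ℝ)

/-- Adding the sum to its mirror image turns the weight j + 1 of `centralBinom j = (j + 1) * catalan
j` into the constant n + 2, which leaves the Catalan convolution. -/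
theorem two_mul_sum_catalan_mul_centralBinom (n : ℕ) :
    2 * ∑ ij ∈ Finset.HasAntidiagonal.antidiagonal n, (catalan ij.1 : ℝ) * ij.2.centralBinom =
      (n + 1).centralBinom := by
  have hB (j : ℕ) : (j.centralBinom : ℝ) = (j + 1) * catalan j := by
    exact_mod_cast (succ_mul_catalan_eq_centralBinom j).symm
  rw [two_mul]
  nth_rw 2 [← Finset.Nat.sum_antidiagonal_swap]
  rw [← Finset.sum_add_distrib, hB, catalan_succ']
  push_cast
  rw [Finset.mul_sum]
  refine Finset.sum_congr rfl fun ij hij => ?_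
  have : (ij.1 : ℝ) + ij.2 = n := by exact_mod_cast Finset.HasAntidiagonal.mem_antidiagonal.mp hij
  simp only [hB, Prod.fst_swap, Prod.snd_swap, ← this]
  ring

theorem catalan_mul_centralBinomSeries :
    genFun (fun _ => 1) * centralBinomSeries + genFun (fun _ => 1) = 2 * centralBinomSeries := by
  ext n
  have h := two_mul_sum_catalan_mul_centralBinom n
  have h1 : ((n : ℝ) + 1) * (n + 1).centralBinom = 2 * (2 * n + 1) * n.centralBinom := by
    exact_mod_cast Nat.succ_mul_centralBinom_succ n
  have h2 : ((n : ℝ) + 1) * catalan n = n.centralBinom := by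
    exact_mod_cast succ_mul_catalan_eq_centralBinom n
  rw [two_mul, map_add, map_add, coeff_mul]
  simp only [coeff_genFun_one, centralBinomSeries, coeff_mk]
  have h3 : (n : ℝ) + 1 ≠ 0 := by positivity
  apply mul_left_cancel₀ h3
  linear_combination ((n : ℝ) + 1) / 2 * h + h1 / 2 + h2

/-- If `w` is additive over the nodes of a tree, a node with left subtree `l` contributing `p l`,
then `p + w` has an explicit generating function. -/
theorem two_mul_genFun_add {p w : BinaryTree Unit → ℝ} (h0 : w nil = 0)
    (hw : ∀ l r, w (node () l r) = p l + w l + w r) :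
    2 * genFun (fun b => p b + w b) = genFun p + genFun p * centralBinomSeries := by
  have hrec : genFun w = X * (genFun (fun b => p b + w b) * genFun (fun _ => 1) +
      genFun (fun _ => 1) * genFun w) := by
    ext n
    cases n with
    | zero => simp [coeff_genFun, treesOfNumNodesEq_zero, -coeff_zero_eq_constantCoeff, coeff_zero_X_mul, h0]
    | succ n =>
      rw [coeff_genFun, sum_treesOfNumNodesEq_succ, coeff_succ_X_mul, map_add, coeff_mul, coeff_mul,
        ← Finset.sum_add_distrib]
      refine Finset.sum_congr rfl fun ij _ => ?_
      simp only [coeff_genFun, hw, Finset.sum_mul_sum, ← Finset.sum_add_distrib]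
      simp
  have hadd := genFun_add p w
  have hc := genFun_one
  have hB := catalan_mul_centralBinomSeries
  have h1 : (genFun (fun _ => 1) : PowerSeries ℝ) ≠ 0 := by
    intro h
    have := coeff_genFun_one 0
    simp [h] at this
  set c := genFun (fun _ => 1)
  set v := genFun fun b => p b + w b
  -- Multiplying by c and replacing X c² by c - 1 avoids inverting 1 - X c.
  have hw' : genFun w = (c - 1) * v := by
    linear_combination c * hrec - (genFun w + v) * hc
  have hv : (2 - c) * v = genFun p := by linear_combination hadd + hw'
  linear_combination (1 + centralBinomSeries) * hv + v * hB

end BinaryTree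

-- Plane forests as binary trees; counting marked vertices.

namespace PlaneTree

open BinaryTree (treesOfNumNodesEq mem_treesOfNumNodesEq)

/-- The first-child next-sibling correspondence from binary trees to ordered forests. -/
def toForest : BinaryTree Unit → List PlaneTree
  | .nil => []
  | .node _ l r => node (toForest l) :: toForest r

theorem toForest_injective : Function.Injective toForest := by
  intro a
  induction a with
  | nil => intro b h; cases b <;> simp_all [toForest]
  | node _ l r hl hr =>
    intro b h
    cases b with
    | nil => simp [toForest] at h
    | node _ l' r' =>
      simp only [toForest, List.cons.injEq, node.injEq] at h
      rw [hl h.1, hr h.2]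

theorem sizeForest_toForest (b : BinaryTree Unit) : sizeForest (toForest b) = b.numNodes := by
  induction b with
  | nil => simp [toForest, sizeForest]
  | node _ l r hl hr => simp [toForest, sizeForest, size, hl, hr]; omega

theorem toForest_surjective : Function.Surjective toForest := by
  intro l
  induction hn : sizeForest l using Nat.strong_induction_on generalizing l with
  | _ n ih =>
    match l with
    | [] => exact ⟨.nil, rfl⟩
    | node m :: l =>
      simp only [sizeForest, size] at hn
      obtain ⟨a, rfl⟩ := ih _ (by omega) m rfl
      obtain ⟨b, rfl⟩ := ih _ (by omega) l rfl
      exact ⟨.node () a b, rfl⟩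

/-- The addresses of the vertices of `t` whose subtree satisfies `P`. -/
def verticesWith (P : PlaneTree → Prop) (t : PlaneTree) : Set (List ℕ) :=
  {v | ∃ s, t.subtreeAt v = some s ∧ P s}

theorem subtreeAt_nil (t : PlaneTree) : t.subtreeAt [] = some t := by
  cases t; rfl

theorem subtreeAt_node_cons (l : List PlaneTree) (i : ℕ) (v : List ℕ) :
    (node l).subtreeAt (i :: v) = l[i]?.bind fun s => s.subtreeAt v := by
  rw [subtreeAt]; rfl

theorem subtreeAt_append (t : PlaneTree) (v p : List ℕ) :
    t.subtreeAt (v ++ p) = (t.subtreeAt v).bind fun s => s.subtreeAt p := by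
  induction v generalizing t with
  | nil => simp [subtreeAt_nil]
  | cons i v ih =>
    cases t with
    | node l => simp [subtreeAt_node_cons, Option.bind_assoc, ih]

/-- The addresses, in `node l`, of the vertices in the forest `l` whose subtree satisfies `P`. -/
def forestVerticesWith (P : PlaneTree → Prop) (l : List PlaneTree) : Set (List ℕ) :=
  {v | v ≠ [] ∧ v ∈ verticesWith P (node l)}

open Classical in
theorem encard_verticesWith_node (P : PlaneTree → Prop) (l : List PlaneTree) :
    (verticesWith P (node l)).encard =
      (if P (node l) then 1 else 0) + (forestVerticesWith P l).encard := by
  have hmem : [] ∈ verticesWith P (node l) ↔ P (node l) := by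
    simp [verticesWith, subtreeAt_nil]
  split_ifs with h
  · have : verticesWith P (node l) = insert [] (forestVerticesWith P l) := by
      ext v
      by_cases hv : v = [] <;> simp [forestVerticesWith, hv, hmem, h]
    rw [this, Set.encard_insert_of_notMem (by simp [forestVerticesWith]), add_comm]
  · have : verticesWith P (node l) = forestVerticesWith P l := by
      ext v
      by_cases hv : v = [] <;> simp [forestVerticesWith, hv, hmem, h]
    rw [this, zero_add]

theorem forestVerticesWith_nil (P : PlaneTree → Prop) : forestVerticesWith P [] = ∅ := by
  ext v
  cases v <;> simp [forestVerticesWith, verticesWith, subtreeAt_node_cons]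

theorem encard_forestVerticesWith_cons (P : PlaneTree → Prop) (t : PlaneTree)
    (l : List PlaneTree) : (forestVerticesWith P (t :: l)).encard =
      (verticesWith P t).encard + (forestVerticesWith P l).encard := by
  -- Prepending a tree raises the first index of every old address by one. The default value of
  -- `headI` is harmless, since forest addresses are nonempty.
  let shift : List ℕ → List ℕ := fun v => (v.headI + 1) :: v.tail
  have hshift : Set.InjOn shift (forestVerticesWith P l) := by
    rintro (_ | ⟨i, v⟩) hv (_ | ⟨j, w⟩) hw h <;> simp_all [forestVerticesWith, shift]
  have hcons : Function.Injective (List.cons 0 : List ℕ → List ℕ) := fun v w h => by simpa using h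
  rw [← hshift.encard_image, ← hcons.encard_image (verticesWith P t), ← Set.encard_union_eq]
  · congr 1
    ext v
    match v with
    | [] => simp [forestVerticesWith, shift]
    | 0 :: v => simp [forestVerticesWith, verticesWith, shift, subtreeAt_node_cons]
    | (i + 1) :: v =>
      simp only [forestVerticesWith, verticesWith, Set.mem_ofPred_eq, subtreeAt_node_cons,
        Set.mem_union, Set.mem_image, shift, ne_eq, reduceCtorEq, not_false_eq_true, true_and,
        List.getElem?_cons_succ]
      constructor
      · intro h
        exact Or.inr ⟨i :: v, ⟨by simp, by simpa [subtreeAt_node_cons] using h⟩, by simp⟩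
      · rintro (⟨w, _, hw⟩ | ⟨w, ⟨hw, hw'⟩, h⟩)
        · simp at hw
        · obtain _ | ⟨j, w⟩ := w
          · exact absurd rfl hw
          · simp at h
            obtain ⟨rfl, rfl⟩ := h
            simpa [subtreeAt_node_cons] using hw'
  · rw [Set.disjoint_left]
    rintro _ ⟨v, _, rfl⟩ ⟨w, _, h⟩
    simp [shift] at h

open Classical in
/-- The number of non-root vertices of `node (toForest b)` whose subtree satisfies `P`. -/
noncomputable def forestCount (P : PlaneTree → Prop) : BinaryTree Unit → ℕ
  | .nil => 0
  | .node _ l r => (if P (node (toForest l)) then 1 else 0) + forestCount P l + forestCount P r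

theorem encard_forestVerticesWith_toForest (P : PlaneTree → Prop) (b : BinaryTree Unit) :
    (forestVerticesWith P (toForest b)).encard = forestCount P b := by
  induction b with
  | nil => simp [toForest, forestVerticesWith_nil, forestCount]
  | node _ l r hl hr =>
    rw [toForest, encard_forestVerticesWith_cons, encard_verticesWith_node, hl, hr, forestCount]
    push_cast
    rfl

open Classical in
theorem encard_verticesWith_toForest (P : PlaneTree → Prop) (b : BinaryTree Unit) :
    (verticesWith P (node (toForest b))).encard =
      ((if P (node (toForest b)) then 1 else 0) + forestCount P b : ℕ) := by
  rw [encard_verticesWith_node, encard_forestVerticesWith_toForest]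
  push_cast
  rfl

open Classical in
theorem ncard_size_verticesWith (P : PlaneTree → Prop) (n : ℕ) :
    {x : PlaneTree × List ℕ | x.1.size = n + 1 ∧ x.2 ∈ verticesWith P x.1}.ncard =
      ∑ b ∈ treesOfNumNodesEq n, ((if P (node (toForest b)) then 1 else 0) + forestCount P b) := by
  have hfin (b : BinaryTree Unit) : (verticesWith P (node (toForest b))).Finite :=
    Set.finite_of_encard_eq_coe (encard_verticesWith_toForest P b)
  have heq : {x : PlaneTree × List ℕ | x.1.size = n + 1 ∧ x.2 ∈ verticesWith P x.1} =
      ((treesOfNumNodesEq n).biUnion fun b =>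
        (hfin b).toFinset.map (Function.Embedding.sectR (node (toForest b)) _) : Finset _) := by
    ext ⟨⟨l⟩, v⟩
    obtain ⟨a, rfl⟩ := toForest_surjective l
    simp only [size, sizeForest_toForest, Set.mem_ofPred_eq, Finset.coe_biUnion, Finset.coe_map,
      Set.Finite.coe_toFinset, Set.mem_iUnion, Set.mem_image, Function.Embedding.sectR_apply,
      Prod.mk.injEq, node.injEq, SetLike.mem_coe, mem_treesOfNumNodesEq, exists_prop]
    constructor
    · rintro ⟨h, hv⟩
      exact ⟨a, by omega, v, hv, rfl, rfl⟩
    · rintro ⟨b, hb, w, hw, h, rfl⟩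
      obtain rfl := toForest_injective h
      exact ⟨by omega, hw⟩
  rw [heq, Set.ncard_coe_finset, Finset.card_biUnion]
  · refine Finset.sum_congr rfl fun b _ => ?_
    rw [Finset.card_map, ← Set.ncard_eq_toFinset_card _ (hfin b), Set.ncard, encard_verticesWith_toForest,
      ENat.toNat_natCast]
  · intro a _ b _ hab
    rw [Function.onFun, Finset.disjoint_left]
    simp only [Finset.mem_map, Function.Embedding.sectR_apply, not_exists, not_and]
    rintro _ ⟨v, _, rfl⟩ w _ h
    simp only [Prod.mk.injEq, node.injEq] at h
    exact hab (toForest_injective h.1).symm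

-- Rank in terms of leaf depths.

/-- All leaves of `t` have depth at least `k`. -/
def MinLeafDepthGE (k : ℕ) (t : PlaneTree) : Prop :=
  ∀ p, t.IsLeaf p → k ≤ p.length

theorem minLeafDepthGE_zero (t : PlaneTree) : MinLeafDepthGE 0 t := fun _ _ => Nat.zero_le _

theorem minLeafDepthGE_succ_node (k : ℕ) (l : List PlaneTree) :
    MinLeafDepthGE (k + 1) (node l) ↔ l ≠ [] ∧ ∀ s ∈ l, MinLeafDepthGE k s := by
  constructor
  · refine fun h => ⟨?_, fun s hs p hp => ?_⟩
    · rintro rfl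
      exact absurd (h [] (subtreeAt_nil _)) (by simp)
    · obtain ⟨i, hi⟩ := List.mem_iff_getElem?.mp hs
      have := h (i :: p) (by simpa [IsLeaf, subtreeAt_node_cons, hi] using hp)
      simpa using this
  · rintro ⟨h0, h⟩ (_ | ⟨i, p⟩) hp
    · simp [IsLeaf, subtreeAt_nil, h0] at hp
    · simp only [IsLeaf, subtreeAt_node_cons, Option.bind_eq_some_iff] at hp
      obtain ⟨s, hs, hp⟩ := hp
      have := h s (List.mem_of_getElem? hs) p hp
      simpa using this

/-- The leaves below v are the leaves of the subtree at v, so rank depends on that subtree only.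
Failure of the bound k + 1 supplies the leaf at depth k. -/
theorem rankCount_eq_ncard (k n : ℕ) : rankCount k n =
    {x : PlaneTree × List ℕ | x.1.size = n ∧
      x.2 ∈ verticesWith (fun s => MinLeafDepthGE k s ∧ ¬ MinLeafDepthGE (k + 1) s) x.1}.ncard := by
  unfold rankCount
  congr 1
  ext ⟨t, v⟩
  simp only [Set.mem_ofPred_eq, and_congr_right_iff, IsVertex, verticesWith]
  intro _
  rw [← exists_and_right]
  refine exists_congr fun s => and_congr_right fun hs => ?_
  have hleaf (p : List ℕ) : t.IsLeaf (v ++ p) ↔ s.IsLeaf p := by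
    simp [IsLeaf, subtreeAt_append, hs]
  simp only [HasRank, hleaf]
  constructor
  · rintro ⟨⟨p, hp, hl⟩, hk⟩
    exact ⟨fun q hq => hk ⟨q, rfl, hq⟩, fun h => absurd (h p hl) (by omega)⟩
  · rintro ⟨hk, hk'⟩
    simp only [MinLeafDepthGE, not_forall, not_le] at hk'
    obtain ⟨p, hp, hlt⟩ := hk'
    refine ⟨⟨p, by have := hk p hp; omega, hp⟩, ?_⟩
    rintro _ ⟨q, rfl, hq⟩
    exact hk q hq

end PlaneTree

-- Evaluation of power series at 1/4.

namespace PowerSeries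

open scoped PowerSeries Topology

/-- The power series `a` converges at `1 / 4` with sum `A`. -/
def HasSumAtQuarter (a : ℝ⟦X⟧) (A : ℝ) : Prop :=
  HasSum (fun n => coeff n a * (1 / 4) ^ n) A

namespace HasSumAtQuarter

variable {a b : ℝ⟦X⟧} {A B : ℝ}

theorem unique (h : HasSumAtQuarter a A) (h' : HasSumAtQuarter a B) : A = B := HasSum.unique h h'

theorem add (ha : HasSumAtQuarter a A) (hb : HasSumAtQuarter b B) :
    HasSumAtQuarter (a + b) (A + B) := by
  simpa [HasSumAtQuarter, add_mul] using HasSum.add ha hb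

theorem sub (ha : HasSumAtQuarter a A) (hb : HasSumAtQuarter b B) :
    HasSumAtQuarter (a - b) (A - B) := by
  simpa [HasSumAtQuarter, sub_mul] using HasSum.sub ha hb

theorem mul (ha : HasSumAtQuarter a A) (hb : HasSumAtQuarter b B) :
    HasSumAtQuarter (a * b) (A * B) := by
  have hterm : (fun n => coeff n (a * b) * (1 / 4 : ℝ) ^ n) = fun n =>
      ∑ ij ∈ Finset.HasAntidiagonal.antidiagonal n,
        coeff ij.1 a * (1 / 4) ^ ij.1 * (coeff ij.2 b * (1 / 4) ^ ij.2) := by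
    ext n
    rw [coeff_mul, Finset.sum_mul]
    refine Finset.sum_congr rfl fun ij hij => ?_
    rw [← Finset.HasAntidiagonal.mem_antidiagonal.mp hij, pow_add]
    ring
  have hsa := (HasSum.summable ha).norm
  have hsb := (HasSum.summable hb).norm
  have h := (summable_norm_sum_mul_antidiagonal_of_summable_norm hsa hsb).of_norm.hasSum
  rw [← tsum_mul_tsum_eq_tsum_sum_antidiagonal_of_summable_norm hsa hsb, HasSum.tsum_eq ha,
    HasSum.tsum_eq hb] at h
  rw [HasSumAtQuarter, hterm]
  exact h

end HasSumAtQuarter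

theorem hasSumAtQuarter_C (r : ℝ) : HasSumAtQuarter (C r) r := by
  have h := hasSum_single (f := fun n => coeff n (C r) * (1 / 4 : ℝ) ^ n) 0
    fun n hn => by simp [coeff_C, hn]
  simpa [HasSumAtQuarter] using h

theorem hasSumAtQuarter_X : HasSumAtQuarter X (1 / 4) := by
  have h := hasSum_single (f := fun n => coeff n (X : ℝ⟦X⟧) * (1 / 4 : ℝ) ^ n) 1
    fun n hn => by simp [coeff_X, hn]
  simpa [HasSumAtQuarter] using h

end PowerSeries

-- Coefficient asymptotics against central binomial coefficients.

namespace BinaryTree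

open PowerSeries
open scoped PowerSeries Topology

theorem sum_catalan_mul_quarter_pow (n : ℕ) :
    ∑ i ∈ Finset.range n, (catalan i : ℝ) * (1 / 4) ^ i = 2 - 2 * n.centralBinom * (1 / 4) ^ n := by
  induction n with
  | zero => simp
  | succ n ih =>
    have h1 : ((n : ℝ) + 1) * (n + 1).centralBinom = 2 * (2 * n + 1) * n.centralBinom := by
      exact_mod_cast Nat.succ_mul_centralBinom_succ n
    have h2 : ((n : ℝ) + 1) * catalan n = n.centralBinom := by
      exact_mod_cast succ_mul_catalan_eq_centralBinom n
    rw [Finset.sum_range_succ, ih, pow_succ]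
    have h3 : (n : ℝ) + 1 ≠ 0 := by positivity
    apply mul_left_cancel₀ h3
    linear_combination (1 / 4 : ℝ) ^ n * (h2 + h1 / 2)

theorem summable_catalan_mul_quarter_pow : Summable fun i => (catalan i : ℝ) * (1 / 4) ^ i := by
  refine summable_of_sum_range_le (c := 2) (fun n => by positivity) fun n => ?_
  rw [sum_catalan_mul_quarter_pow]
  have : (0 : ℝ) ≤ 2 * n.centralBinom * (1 / 4) ^ n := by positivity
  linarith

theorem coeff_genFun_nonneg {f : BinaryTree Unit → ℝ} (h0 : ∀ b, 0 ≤ f b) (n : ℕ) :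
    0 ≤ coeff n (genFun f) := by
  rw [coeff_genFun]
  exact Finset.sum_nonneg fun b _ => h0 b

theorem coeff_genFun_le_catalan {f : BinaryTree Unit → ℝ} (h1 : ∀ b, f b ≤ 1) (n : ℕ) :
    coeff n (genFun f) ≤ catalan n := by
  rw [← coeff_genFun_one, coeff_genFun, coeff_genFun]
  exact Finset.sum_le_sum fun b _ => h1 b

theorem exists_hasSumAtQuarter_genFun {f : BinaryTree Unit → ℝ} (h0 : ∀ b, 0 ≤ f b)
    (h1 : ∀ b, f b ≤ 1) : ∃ A, HasSumAtQuarter (genFun f) A := by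
  have : Summable fun n => coeff n (genFun f) * (1 / 4 : ℝ) ^ n :=
    summable_catalan_mul_quarter_pow.of_nonneg_of_le
      (fun n => mul_nonneg (coeff_genFun_nonneg h0 n) (by positivity))
      fun n => mul_le_mul_of_nonneg_right (coeff_genFun_le_catalan h1 n) (by positivity)
  exact this

theorem hasSumAtQuarter_genFun_one : HasSumAtQuarter (genFun fun _ => 1) 2 := by
  obtain ⟨A, hA⟩ := exists_hasSumAtQuarter_genFun (f := fun _ => 1) (by simp) (by simp)
  have h := (hasSumAtQuarter_C 1).add (hasSumAtQuarter_X.mul (hA.mul hA))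
  rw [map_one, ← genFun_one] at h
  have h2 := hA.unique h
  -- The equation A = 1 + A²/4 has the double root 2.
  have : (A - 2) ^ 2 = 0 := by linear_combination -4 * h2
  have : A = 2 := by linarith [pow_eq_zero_iff (two_ne_zero) |>.mp this]
  exact this ▸ hA

theorem tendsto_centralBinom_div_centralBinom_add (i : ℕ) :
    Tendsto (fun n : ℕ => (n.centralBinom : ℝ) / (n + i).centralBinom) atTop
      (𝓝 ((1 / 4) ^ i)) := by
  have hpos (m : ℕ) : (m.centralBinom : ℝ) ≠ 0 := by exact_mod_cast m.centralBinom_ne_zero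
  have hstep : Tendsto (fun n : ℕ => (n.centralBinom : ℝ) / (n + 1).centralBinom) atTop
      (𝓝 (1 / 4)) := by
    have heq (n : ℕ) : (n.centralBinom : ℝ) / (n + 1).centralBinom =
        1 / 4 + 1 / 8 * (1 / ((n : ℝ) + 1 / 2)) := by
      have h1 : ((n : ℝ) + 1) * (n + 1).centralBinom = 2 * (2 * n + 1) * n.centralBinom := by
        exact_mod_cast Nat.succ_mul_centralBinom_succ n
      have h2 : (n : ℝ) + 1 / 2 ≠ 0 := by positivity
      have h3 : 2 * (n : ℝ) + 1 ≠ 0 := by positivity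
      rw [div_eq_iff (hpos _)]
      field_simp
      linear_combination -16 * h1
    simp_rw [heq]
    have h0 : Tendsto (fun n : ℕ => 1 / ((n : ℝ) + 1 / 2)) atTop (𝓝 0) :=
      tendsto_const_nhds.div_atTop
        (tendsto_atTop_add_const_right _ _ tendsto_natCast_atTop_atTop)
    have h := (h0.const_mul (1 / 8)).const_add (1 / 4 : ℝ)
    rwa [mul_zero, add_zero] at h
  induction i with
  | zero => simp [hpos]
  | succ i ih =>
    rw [pow_succ]
    refine (ih.mul (hstep.comp (tendsto_add_atTop_nat i))).congr fun n => ?_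
    simp only [Function.comp_apply]
    rw [div_mul_div_cancel₀ (hpos _), add_assoc]

theorem tendsto_centralBinom_sub_div_centralBinom (i : ℕ) :
    Tendsto (fun n : ℕ => ((n - i).centralBinom : ℝ) / n.centralBinom) atTop
      (𝓝 ((1 / 4) ^ i)) := by
  rw [← tendsto_add_atTop_iff_nat i]
  simpa using tendsto_centralBinom_div_centralBinom_add i

/-- Nonnegativity allows the convolution to be cut to its first M terms, which converge one by one
to a partial sum exceeding r. -/
theorem eventually_sub_lt_coeff_div_centralBinom {p : ℝ⟦X⟧} (h0 : ∀ n, 0 ≤ coeff n p) {S : ℝ}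
    (hS : HasSumAtQuarter p S) {r : ℝ} (hr : r < S) :
    ∀ᶠ n in atTop, r < coeff n (p + p * centralBinomSeries) / n.centralBinom := by
  obtain ⟨M, hM⟩ := ((HasSum.tendsto_sum_nat hS).eventually_const_lt hr).exists
  have hlim : Tendsto (fun n : ℕ => ∑ i ∈ Finset.range M,
      coeff i p * (((n - i).centralBinom : ℝ) / n.centralBinom)) atTop
      (𝓝 (∑ i ∈ Finset.range M, coeff i p * (1 / 4) ^ i)) :=
    tendsto_finsetSum _ fun i _ => (tendsto_centralBinom_sub_div_centralBinom i).const_mul _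
  filter_upwards [hlim.eventually_const_lt hM, eventually_ge_atTop M] with n hn hnM
  refine hn.trans_le ?_
  simp_rw [← mul_div_assoc]
  rw [← Finset.sum_div]
  gcongr
  rw [map_add, coeff_mul, Finset.Nat.sum_antidiagonal_eq_sum_range_succ_mk]
  simp only [centralBinomSeries, coeff_mk]
  refine le_add_of_nonneg_of_le (h0 n) (Finset.sum_le_sum_of_subset_of_nonneg ?_ ?_)
  · exact Finset.range_subset_range.mpr (by omega)
  · exact fun i _ _ => mul_nonneg (h0 i) (Nat.cast_nonneg _)

/-- The upper bound is the lower bound for 1 - f: the two quotients add up to exactly 2, because c +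
cB = 2B, and so do the two limits, because c(1/4) = 2. No tail estimate is needed. -/
theorem tendsto_coeff_div_centralBinom {f : BinaryTree Unit → ℝ} (h0 : ∀ b, 0 ≤ f b)
    (h1 : ∀ b, f b ≤ 1) {S : ℝ} (hS : HasSumAtQuarter (genFun f) S) :
    Tendsto (fun n => coeff n (genFun f + genFun f * centralBinomSeries) / n.centralBinom) atTop
      (𝓝 S) := by
  refine tendsto_order.mpr ⟨fun r hr =>
    eventually_sub_lt_coeff_div_centralBinom (coeff_genFun_nonneg h0) hS hr, fun r hr => ?_⟩
  have hS' : HasSumAtQuarter (genFun fun b => 1 - f b) (2 - S) := by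
    rw [genFun_sub]
    exact hasSumAtQuarter_genFun_one.sub hS
  have h := eventually_sub_lt_coeff_div_centralBinom
    (coeff_genFun_nonneg fun b => sub_nonneg.mpr (h1 b)) hS' (r := 2 - r) (by linarith)
  filter_upwards [h] with n hn
  have htot : (genFun fun b => 1 - f b) + (genFun fun b => 1 - f b) * centralBinomSeries =
      centralBinomSeries + centralBinomSeries - (genFun f + genFun f * centralBinomSeries) := by
    rw [genFun_sub]
    linear_combination catalan_mul_centralBinomSeries
  have hpos : (n.centralBinom : ℝ) ≠ 0 := by exact_mod_cast n.centralBinom_ne_zero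
  rw [htot, map_sub, map_add, sub_div, add_div] at hn
  simp only [centralBinomSeries, coeff_mk, div_self hpos] at hn ⊢
  linarith

end BinaryTree

-- The values at 1/4 and the limit.

namespace PlaneTree

open PowerSeries BinaryTree
open scoped Topology

open Classical in
theorem hasSumAtQuarter_minLeafDepthGE (k : ℕ) :
    HasSumAtQuarter (genFun fun b => if MinLeafDepthGE k (node (toForest b)) then 1 else 0)
      (6 / (2 + 4 ^ k)) := by
  induction k with
  | zero =>
    simp only [minLeafDepthGE_zero, if_true]
    convert hasSumAtQuarter_genFun_one using 1
    norm_num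
  | succ k ih =>
    -- Forests of admissible trees, the empty one included: F = 1 + X G F with G the series for k,
    -- and F - 1 is the series for k + 1. Domination by Catalan numbers gives convergence, so the
    -- equation may be evaluated at 1/4.
    let f : BinaryTree Unit → ℝ := fun b => if ∀ s ∈ toForest b, MinLeafDepthGE k s then 1 else 0
    obtain ⟨F, hF⟩ := exists_hasSumAtQuarter_genFun (f := f)
      (fun b => by simp only [f]; split_ifs <;> norm_num)
      (fun b => by simp only [f]; split_ifs <;> norm_num)
    have hrec : genFun f = C 1 + X * ((genFun fun b =>
        if MinLeafDepthGE k (node (toForest b)) then 1 else 0) * genFun f) := by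
      have h := genFun_eq_of_node (f := f) (g := fun b =>
        if MinLeafDepthGE k (node (toForest b)) then 1 else 0) (h := f) fun l r => by
          simp [f, toForest, ← ite_and, and_comm]
      simpa [f, toForest] using h
    have hnext : (genFun fun b =>
        if MinLeafDepthGE (k + 1) (node (toForest b)) then 1 else 0) = genFun f - C 1 := by
      have h := genFun_eq_of_node (g := fun b =>
        if MinLeafDepthGE k (node (toForest b)) then 1 else 0) (h := f)
        (f := fun b => if MinLeafDepthGE (k + 1) (node (toForest b)) then 1 else 0) fun l r => by
          simp [f, toForest, ← ite_and, minLeafDepthGE_succ_node, and_comm]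
      rw [h, eq_sub_iff_add_eq]
      nth_rw 2 [hrec]
      simp [toForest, minLeafDepthGE_succ_node, add_comm]
    have hF' := (hasSumAtQuarter_C 1).add (hasSumAtQuarter_X.mul (ih.mul hF))
    rw [← hrec] at hF'
    have heq := hF.unique hF'
    rw [hnext]
    convert hF.sub (hasSumAtQuarter_C 1) using 1
    have h4 : (0 : ℝ) < 4 ^ k := by positivity
    field_simp at heq
    rw [div_eq_iff (by positivity), pow_succ]
    linear_combination -heq

theorem tendsto_rankCount_succ_div_centralBinom (k : ℕ) :
    Tendsto (fun n => (rankCount k (n + 1) : ℝ) / n.centralBinom) atTop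
      (𝓝 ((6 / (2 + 4 ^ k) - 6 / (2 + 4 ^ (k + 1))) / 2)) := by
  classical
  let P : PlaneTree → Prop := fun s => MinLeafDepthGE k s ∧ ¬ MinLeafDepthGE (k + 1) s
  let p : BinaryTree Unit → ℝ := fun b => if P (node (toForest b)) then 1 else 0
  have hsum : HasSumAtQuarter (genFun p) (6 / (2 + 4 ^ k) - 6 / (2 + 4 ^ (k + 1))) := by
    have h := (hasSumAtQuarter_minLeafDepthGE k).sub (hasSumAtQuarter_minLeafDepthGE (k + 1))
    rw [← genFun_sub] at h
    convert h using 3 with b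
    have hmono : MinLeafDepthGE (k + 1) (node (toForest b)) →
        MinLeafDepthGE k (node (toForest b)) := fun h q hq => (Nat.le_succ k).trans (h q hq)
    by_cases h1 : MinLeafDepthGE (k + 1) (node (toForest b))
    · simp [p, P, h1, hmono h1]
    · simp [p, P, h1]
  have hlim := tendsto_coeff_div_centralBinom (f := p)
    (fun b => by simp only [p]; split_ifs <;> norm_num)
    (fun b => by simp only [p]; split_ifs <;> norm_num) hsum
  have hcount (n : ℕ) : 2 * (rankCount k (n + 1) : ℝ) =
      coeff n (genFun p + genFun p * centralBinomSeries) := by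
    rw [← two_mul_genFun_add (w := fun b => (forestCount P b : ℝ)) (by simp [forestCount])
      (fun l r => by simp [forestCount, p]), two_mul (genFun _), map_add, coeff_genFun, ← two_mul,
      rankCount_eq_ncard, ncard_size_verticesWith]
    push_cast
    rfl
  refine (hlim.div_const 2).congr fun n => ?_
  rw [← hcount]
  ring

end PlaneTree

theorem corollary2 (k : ℕ) :
    (fun n : ℕ => (PlaneTree.rankCount k n : ℝ)) ~[atTop]
      (fun n : ℕ => 9 * (Nat.choose (2 * n - 2) (n - 1) : ℝ) /
        (10 + (4 : ℝ) ^ (1 - (k : ℤ)) + (4 : ℝ) ^ (1 + (k : ℤ)))) := by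
  have hD : 0 < 10 + (4 : ℝ) ^ (1 - (k : ℤ)) + (4 : ℝ) ^ (1 + (k : ℤ)) := by positivity
  have hchoose (n : ℕ) : (2 * (n + 1) - 2).choose (n + 1 - 1) = n.centralBinom := by
    rw [Nat.centralBinom_eq_two_mul_choose]
    congr 1
  have hpos (n : ℕ) : (n.centralBinom : ℝ) ≠ 0 := by exact_mod_cast n.centralBinom_ne_zero
  have hconst : (6 / (2 + 4 ^ k) - 6 / (2 + 4 ^ (k + 1))) / 2 =
      9 / (10 + (4 : ℝ) ^ (1 - (k : ℤ)) + (4 : ℝ) ^ (1 + (k : ℤ))) := by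
    rw [eq_div_iff hD.ne', zpow_sub₀ (by norm_num), zpow_add₀ (by norm_num), zpow_one,
      zpow_natCast, pow_succ]
    have h4 : (0 : ℝ) < 4 ^ k := by positivity
    field_simp
    ring
  have hlim := PlaneTree.tendsto_rankCount_succ_div_centralBinom k
  rw [hconst] at hlim
  -- Passing to size n + 1 removes the truncated subtractions.
  refine isEquivalent_of_tendsto_one ((tendsto_add_atTop_iff_nat 1).mp ?_)
  have h := hlim.div_const (9 / (10 + (4 : ℝ) ^ (1 - (k : ℤ)) + (4 : ℝ) ^ (1 + (k : ℤ))))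
  rw [div_self (by positivity)] at h
  refine h.congr fun n => ?_
  simp only [Pi.div_apply, hchoose]
  rw [div_div]
  congr 1
  ring
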